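/- Let $C$ be a locally presentable category with a cofibrantly generated weak factorization system $(\mathcal L,\mathcal R)$ such that $\emptyset\to X$ is in $\mathcal L$ for every object $X$. For a class $T$ of morphisms let $l(T)$ and $r(T)$ denote the classes of morphisms with the left, respectively right, lifting property against $T$. A functorial cylinder on $C$ is an endofunctor $I$ of $C$ with natural transformations $\partial_0,\partial_1\colon \mathrm{id}_C\Rightarrow I$ and $\sigma\colon I\Rightarrow \mathrm{id}_C$ such that $\sigma\partial_0=\mathrm{id}=\sigma\partial_1$ and $(\partial_0,\partial_1)\colon X\sqcup X\to IX$ is in $\mathcal L$ for all $X$. For $j\colon K\to L$ let $$\partial I\boxtimes j\colon (L\sqcup L)\sqcup_{K\sqcup K} IK\to IL,\qquad \partial_e\boxtimes j\colon L\sqcup_{K,\partial_e}IK\to IL\quad(e=0,1)$$ be the induced maps. The cylinder is exact if $I$ preserves small colimits and, for each $j\in\mathcal L$, the maps $\partial I\boxtimes j$, $\partial_0\boxtimes j$ and $\partial_1\boxtimes j$ are in $\mathcal L$. An elementary homotopical datum $\mathcal I=(I,S)$ consists of an exact cylinder and a small set $S\subseteq\mathcal L$ of morphisms. A class of right (resp.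 left) $I$-anodyne extensions is a class $\mathcal A\subseteq\mathcal L$ of the form $l(r(\Lambda))$ for a small set $\Lambda\subseteq\mathcal L$, which contains $\partial_1\boxtimes j$ (resp. $\partial_0\boxtimes j$) for all $j\in\mathcal L$ and $\partial I\boxtimes j$ for all $j\in\mathcal A$. The right (resp. left) $\mathcal I$-anodyne extensions are the smallest such class containing $S$; right (resp. left) $\mathcal I$-fibrations are the maps with the right lifting property against them. For an object $A$ and objects $X$, $q\colon W\to A$ of $C/A$, let $[X,W]_{I_A}$ be the quotient of $\mathrm{Hom}_{C/A}(X,W)$ by the equivalence relation generated by homotopies $h\colon IX\to W$ over $A$, where $IX$ lies over $A$ via $IX\xrightarrow{\sigma}X\to A$. A map $X\to Y$ in $C/A$ is a contravariant (resp. covariant) equivalence if $[Y,W]_{I_A}\to[X,W]_{I_A}$ is bijective for all right (resp. left) $\mathcal I$-fibrations $W\to A$. A map $f\colon X\to Y$ of $C$ is $\mathcal I$-final (resp. $\mathcal I$-initial) if for every object $A$ and every $p\colon Y\to A$ the map $f\colon (X,pf)\to (Y,p)$ is a contravariant (resp. covariant) equivalence in $C/A$. **Proposition.** A map of $C$ is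 $\mathcal I$-final if and only if it can be factored as a right $\mathcal I$-anodyne extension followed by a map in $\mathcal R$. A map of $C$ is $\mathcal I$-initial if and only if it can be factored as a left $\mathcal I$-anodyne extension followed by a map in $\mathcal R$. -/

import Mathlib

universe v u

open CategoryTheory Limits

/-- A locally presentable category is cocomplete. -/
instance hasColimits_of_isLocallyPresentable (C : Type u) [Category.{v} C]
    [IsLocallyPresentable.{v} C] : HasColimitsOfSize.{v, v} C := by
  obtain ⟨κ, hκ, h⟩ := IsLocallyPresentable.exists_cardinal.{v} C
  exact h.toHasColimitsOfSize

/-- The data of a functorial cylinder: an endofunctor `I` (`I.obj X` is `I ⊗ X`), the two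
inclusions `∂₀ = d 0` and `∂₁ = d 1`, and the projection `σ`, with `σ ∂₀ = id = σ ∂₁`. The condition
that `X ⊔ X ⟶ I ⊗ X` lies in the left class is part of `FunctorialCylinder.IsExact`. -/
structure FunctorialCylinder (C : Type u) [Category.{v} C] where
  I : C ⥤ C
  d : Fin 2 → (𝟭 C ⟶ I)
  σ : I ⟶ 𝟭 C
  d_σ : ∀ e : Fin 2, d e ≫ σ = 𝟙 (𝟭 C)

namespace FunctorialCylinder

section Homotopy

variable {C : Type u} [Category.{v} C] (J : FunctorialCylinder C)

/-- There is an `I`-homotopy from `f` to `g`. -/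
def Homotopic {X Y : C} (f g : X ⟶ Y) : Prop :=
  ∃ h : J.I.obj X ⟶ Y, (J.d 0).app X ≫ h = f ∧ (J.d 1).app X ≫ h = g

/-- `[X, Y]_I`: the quotient of `X ⟶ Y` by the equivalence relation generated by `I`-homotopy
(`Quot r` is the quotient by the equivalence relation generated by `r`). -/
def HomotopyClasses (X Y : C) : Type v :=
  Quot (fun f g : X ⟶ Y => J.Homotopic f g)

/-- The map `f^* : [Y, W]_I → [X, W]_I` induced by `f : X ⟶ Y`. -/
def precomp {X Y : C} (f : X ⟶ Y) (W : C) : J.HomotopyClasses Y W → J.HomotopyClasses X W :=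
  Quot.map (fun g => f ≫ g) (by
    rintro a b ⟨h, rfl, rfl⟩
    refine ⟨J.I.map f ≫ h, ?_, ?_⟩
    · exact (Category.assoc _ _ _).symm.trans
        ((congrArg (· ≫ h) ((J.d 0).naturality f).symm).trans (Category.assoc _ _ _))
    · exact (Category.assoc _ _ _).symm.trans
        ((congrArg (· ≫ h) ((J.d 1).naturality f).symm).trans (Category.assoc _ _ _)))

/-- An object is fibrant with respect to a class `An` of anodyne extensions if its canonical map to
the terminal object has the right lifting property with respect to `An`. -/
def IsFibrant [HasTerminal C] (An : MorphismProperty C) (W : C) : Prop :=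
  An.rlp (terminal.from W)

/-- The weak equivalences of the model structure attached to the cylinder and to a class `An` of
(right or left) anodyne extensions: the maps `f` such that `f^* : [Y, W]_I → [X, W]_I` is bijective
for all fibrant objects `W`. -/
def IsWeakEquivalence [HasTerminal C] (An : MorphismProperty C) {X Y : C} (f : X ⟶ Y) : Prop :=
  ∀ W : C, IsFibrant An W → Function.Bijective (J.precomp f W)

/-- The cylinder `I_A` on `C/A`, sending `p : X ⟶ A` to `I ⊗ X ⟶ X ⟶ A`. -/
def slice (A : C) : FunctorialCylinder (Over A) where
  I :=
    { obj := fun X => Over.mk (J.σ.app X.left ≫ X.hom)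
      map := fun {X Y} f => Over.homMk (J.I.map f.left) (by simp) }
  d := fun e =>
    { app := fun X => Over.homMk ((J.d e).app X.left) (by
        have h := congrArg (fun t => t.app X.left) (J.d_σ e)
        simp only [NatTrans.comp_app, NatTrans.id_app, Functor.id_obj] at h
        simp [reassoc_of% h])
      naturality := fun X Y f => by
        ext
        exact (J.d e).naturality f.left }
  σ := { app := fun X => Over.homMk (J.σ.app X.left) (by simp) }
  d_σ := fun e => by
    ext X
    have h := congrArg (fun t => t.app X.left) (J.d_σ e)
    simpa using h

end Homotopy

section Exact

variable {C : Type u} [Category.{v} C] [HasBinaryCoproducts C]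
  (J : FunctorialCylinder C)

/-- The component at `X` of `∂₀ ⊔ ∂₁ : ∂I ⊗ X = X ⊔ X ⟶ I ⊗ X`. -/
noncomputable def boundary (X : C) : X ⨿ X ⟶ J.I.obj X :=
  coprod.desc ((J.d 0).app X) ((J.d 1).app X)

theorem boundary_naturality {K L : C} (i : K ⟶ L) :
    coprod.map i i ≫ J.boundary L = J.boundary K ≫ J.I.map i := by
  have h : ∀ e : Fin 2, i ≫ (J.d e).app L = (J.d e).app K ≫ J.I.map i :=
    fun e => (J.d e).naturality i
  simp only [boundary, coprod.map_desc, coprod.desc_comp]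
  exact congrArg₂ coprod.desc (h 0) (h 1)

variable [HasPushouts C]

/-- `∂_e ⊠ i : {e} ⊗ L ⊔_{ {e} ⊗ K } I ⊗ K ⟶ I ⊗ L`. -/
noncomputable def endBox (e : Fin 2) {K L : C} (i : K ⟶ L) :
    pushout i ((J.d e).app K) ⟶ J.I.obj L :=
  pushout.desc ((J.d e).app L) (J.I.map i) ((J.d e).naturality i)

/-- `∂I ⊠ i : ∂I ⊗ L ⊔_{∂I ⊗ K} I ⊗ K ⟶ I ⊗ L`. -/
noncomputable def boundaryBox {K L : C} (i : K ⟶ L) :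
    pushout (coprod.map i i) (J.boundary K) ⟶ J.I.obj L :=
  pushout.desc (J.boundary L) (J.I.map i) (J.boundary_naturality i)

/-- `J` is a functorial cylinder with respect to the left class `L` (first field), and it is
exact (the other fields). -/
structure IsExact (L : MorphismProperty C) : Prop where
  boundary_mem : ∀ X : C, L (J.boundary X)
  preservesColimits : PreservesColimitsOfSize.{v, v} J.I
  boundaryBox_mem : ∀ ⦃X Y : C⦄ (i : X ⟶ Y), L i → L (J.boundaryBox i)
  endBox_mem : ∀ (e : Fin 2) ⦃X Y : C⦄ (i : X ⟶ Y), L i → L (J.endBox e i)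

/-- `An` is a class of `e`-anodyne extensions with respect to the left class `L`: a class of right
`I`-anodyne extensions for `e = 1`, and of left `I`-anodyne extensions for `e = 0`. -/
structure IsAnodyneClass (e : Fin 2) (L An : MorphismProperty C) : Prop where
  le : An ≤ L
  generated : ∃ G : MorphismProperty C, MorphismProperty.IsSmall.{v} G ∧ G ≤ L ∧ An = G.rlp.llp
  endBox_mem : ∀ ⦃X Y : C⦄ (i : X ⟶ Y), L i → An (J.endBox e i)
  boundaryBox_mem : ∀ ⦃X Y : C⦄ (i : X ⟶ Y), An i → An (J.boundaryBox i)

end Exact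

end FunctorialCylinder

/-- An elementary homotopical datum `(I, S)`: an exact cylinder and a small set `S` of morphisms
in the left class `L`. -/
structure ElementaryHomotopicalDatum {C : Type u} [Category.{v} C] [HasPushouts C]
    [HasBinaryCoproducts C] (L : MorphismProperty C) where
  cyl : FunctorialCylinder C
  exact : cyl.IsExact L
  S : MorphismProperty C
  small : MorphismProperty.IsSmall.{v} S
  S_le : S ≤ L

namespace ElementaryHomotopicalDatum

variable {C : Type u} [Category.{v} C] [HasPushouts C] [HasBinaryCoproducts C]
  {L : MorphismProperty C} (D : ElementaryHomotopicalDatum L)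

/-- The smallest class of `e`-anodyne extensions containing `S`, as an intersection. -/
def anodyne (e : Fin 2) : MorphismProperty C := fun _ _ f =>
  ∀ An : MorphismProperty C, D.cyl.IsAnodyneClass e L An → D.S ≤ An → An f

/-- The right anodyne extensions of the datum. -/
def rightAnodyne : MorphismProperty C := D.anodyne 1

/-- The left anodyne extensions of the datum. -/
def leftAnodyne : MorphismProperty C := D.anodyne 0

/-- Contravariant equivalences in `C/A`: the weak equivalences for the cylinder `I_A` and the class
of those maps of `C/A` whose underlying map in `C` is right anodyne. -/
def IsContravariantEquivalence {A : C} {X Y : Over A} (f : X ⟶ Y) : Prop :=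
  (D.cyl.slice A).IsWeakEquivalence (D.rightAnodyne.inverseImage (Over.forget A)) f

/-- Covariant equivalences in `C/A`: the weak equivalences for the cylinder `I_A` and the class
of those maps of `C/A` whose underlying map in `C` is left anodyne. -/
def IsCovariantEquivalence {A : C} {X Y : Over A} (f : X ⟶ Y) : Prop :=
  (D.cyl.slice A).IsWeakEquivalence (D.leftAnodyne.inverseImage (Over.forget A)) f

/-- `f : X ⟶ Y` is final: it is a contravariant equivalence in `C/A` for all `p : Y ⟶ A`. -/
def IsFinal {X Y : C} (f : X ⟶ Y) : Prop :=
  ∀ (A : C) (p : Y ⟶ A),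
    D.IsContravariantEquivalence (Over.homMk f : Over.mk (f ≫ p) ⟶ Over.mk p)

/-- `f : X ⟶ Y` is initial: it is a covariant equivalence in `C/A` for all `p : Y ⟶ A`. -/
def IsInitial {X Y : C} (f : X ⟶ Y) : Prop :=
  ∀ (A : C) (p : Y ⟶ A),
    D.IsCovariantEquivalence (Over.homMk f : Over.mk (f ≫ p) ⟶ Over.mk p)

end ElementaryHomotopicalDatum

/-! Both equivalences are one statement about an end `e` of the cylinder and a class `An` of
`e`-anodyne extensions, `isWeakEquivalence_over_iff_exists_factorization`. Anodyne maps are weak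
equivalences in every slice: lifting along `i` gives surjectivity, lifting along `∂I ⊠ i` gives
injectivity. Maps with the right lifting property against `L` are homotopy equivalences over their
target, because all objects are cofibrant. So a composite of the two is a weak equivalence over
every base. Conversely, the small object argument writes `f` as an anodyne map followed by a
fibration `p : E ⟶ Y`. Over the base `Y` itself, two-out-of-three makes `p` a weak equivalence.
Since `E` is fibrant over `Y`, `p` has a section `s` with `p ≫ s` homotopic to the identity over
`Y`. In a lifting problem against `j` in `L`, composing the bottom map with `s` gives a filler whose
upper triangle commutes up to homotopy. As `∂_e ⊠ j` is anodyne, that homotopy extends, and its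
other end is a strict filler (`rlp_of_isWeakEquivalence`). It remains to see that the intersection
defining `anodyne` is itself an anodyne class. Explicit small generators are closed under the box
operations, and the Leibniz adjunction carries this to their saturation
(`llp_pushout_desc_of_rlp_llp`). -/

/-! ### Adjoint functors, limits and small objects in locally presentable categories. -/

namespace CategoryTheory.IsLocallyPresentable

variable {C : Type u} [Category.{v} C] [IsLocallyPresentable.{v} C]

/-- A functor from a locally presentable category which preserves small colimits is a left
adjoint. -/
lemma isLeftAdjoint_of_preservesColimits {D : Type*} [Category.{v} D] (F : C ⥤ D)
    [PreservesColimitsOfSize.{v, v} F] : F.IsLeftAdjoint := by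
  obtain ⟨κ, _, _⟩ := IsLocallyPresentable.exists_cardinal.{v} C
  let P := isCardinalPresentable C κ
  have hP := isCardinalFilteredGenerator_isCardinalPresentable C κ
  have := hasColimits_of_isLocallyPresentable C
  -- One object suffices: the colimit of all presentable objects `P` equipped with a map `F P ⟶ A`.
  -- Any `X` with a map `F X ⟶ A` is a colimit of presentables, each of which indexes a term of that
  -- colimit.
  have hF : SolutionSetCondition.{v} F.op := by
    intro A
    let Φ := CostructuredArrow (P.ι ⋙ F) A.unop
    have : HasColimitsOfShape Φ C := hasColimitsOfShape_of_essentiallySmall.{v} Φ C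
    have : PreservesColimitsOfShape Φ F :=
      preservesColimitsOfShape_of_equiv (equivSmallModel.{v} Φ).symm F
    let G : Φ ⥤ C := CostructuredArrow.proj (P.ι ⋙ F) A.unop ⋙ P.ι
    let c : Cocone (G ⋙ F) := { pt := A.unop, ι :=
      { app := fun φ => φ.hom
        naturality := fun _ _ f => (CostructuredArrow.w f).trans (Category.comp_id _).symm } }
    have hG := isColimitOfPreserves F (colimit.isColimit G)
    refine ⟨PUnit, fun _ => Opposite.op (colimit G), fun _ => (hG.desc c).op, fun X h => ?_⟩
    obtain ⟨J, _, _, ⟨p⟩⟩ := hP.exists_colimitsOfShape X.unop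
    let obj (j : J) : Φ :=
      CostructuredArrow.mk (Y := ⟨p.diag.obj j, p.prop_diag_obj j⟩)
        (S := P.ι ⋙ F) (F.map (p.ι.app j) ≫ h.unop)
    let d : Cocone p.diag :=
      { pt := colimit G
        ι :=
          { app := fun j => colimit.ι G (obj j)
            naturality := fun i j g => by
              let m : obj i ⟶ obj j := CostructuredArrow.homMk (ObjectProperty.homMk (p.diag.map g))
                (by
                  change F.map (p.diag.map g) ≫ F.map (p.ι.app j) ≫ h.unop =
                    F.map (p.ι.app i) ≫ h.unop
                  rw [← F.map_comp_assoc]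
                  congr 2
                  exact (p.ι.naturality g).trans (Category.comp_id _))
              exact (colimit.w G m).trans (Category.comp_id _).symm } }
    refine ⟨⟨⟩, (p.isColimit.desc d).op, Quiver.Hom.unop_inj ?_⟩
    refine (isColimitOfPreserves F p.isColimit).hom_ext fun j => ?_
    have h₁ : p.ι.app j ≫ p.isColimit.desc d = colimit.ι G (obj j) := p.isColimit.fac d j
    have h₂ : F.map (colimit.ι G (obj j)) ≫ hG.desc c = F.map (p.ι.app j) ≫ h.unop :=
      hG.fac c (obj j)
    change F.map (p.ι.app j) ≫ F.map (p.isColimit.desc d) ≫ hG.desc c =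
      F.map (p.ι.app j) ≫ h.unop
    rw [← h₂, ← F.map_comp_assoc, h₁]
    rfl
  have : PreservesLimitsOfSize.{v, v} F.op := preservesLimitsOfSize_op F
  have : F.op.IsRightAdjoint := isRightAdjoint_of_preservesLimits_of_solutionSetCondition _ hF
  exact ⟨_, ⟨(Adjunction.ofIsRightAdjoint F.op).unop⟩⟩

-- The diagonal functor into a diagram category preserves colimits, so it has a right adjoint.
variable (C) in
lemma hasLimits : HasLimitsOfSize.{v, v} C where
  has_limits_of_shape _ _ :=
    hasLimitsOfShape_iff_isLeftAdjoint_const.2 (isLeftAdjoint_of_preservesColimits _)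

/-- Any small class of morphisms in a locally presentable category permits the small object
argument. -/
lemma hasSmallObjectArgument (I : MorphismProperty C) [MorphismProperty.IsSmall.{v} I] :
    MorphismProperty.HasSmallObjectArgument.{v} I := by
  have := hasColimits_of_isLocallyPresentable C
  obtain ⟨ι, A, B, f, hI⟩ := (MorphismProperty.isSmall_iff_eq_ofHoms.{v} I).1 inferInstance
  have h (i : ι) : ∃ (κ : Cardinal.{v}) (_ : Fact κ.IsRegular), IsCardinalPresentable (A i) κ :=
    Functor.IsAccessible.exists_cardinal (F := coyoneda.obj (Opposite.op (A i)))
  choose κ hκ hA using h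
  -- A single regular `μ` bounds the presentability ranks of all sources, so mapping out of any
  -- source commutes with `μ`-indexed chains.
  obtain ⟨μ, hμ, hμ'⟩ := HasCardinalLT.exists_regular_cardinal_forall.{v} fun i => (κ i).ord.ToType
  have : Fact μ.IsRegular := ⟨hμ⟩
  have hle (i : ι) : κ i ≤ μ := by
    have := hμ' i
    rw [hasCardinalLT_iff_cardinal_mk_lt] at this
    simpa using this.le
  have : Nonempty μ.ord.ToType := by simpa using hμ.ne_zero
  have := WellFoundedLT.toOrderBot μ.ord.ToType
  refine ⟨μ, inferInstance, inferInstance, { preservesColimit := ?_ }⟩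
  intro X Y _ _ i hi _ hf
  rw [hI, MorphismProperty.ofHoms_iff] at hi
  obtain ⟨k, hk⟩ := hi
  obtain rfl : X = A k := congrArg Arrow.leftFunc.obj hk
  have := hA k
  have : IsCardinalPresentable (A k) μ := isCardinalPresentable_of_le _ (hle k)
  have := preservesColimitsOfShape_of_isCardinalPresentable (A k) μ μ.ord.ToType
  infer_instance

end CategoryTheory.IsLocallyPresentable

/-! ### The Leibniz adjunction between pushout and pullback corner maps. -/

namespace CategoryTheory.Adjunction

variable {C : Type*} [Category* C] {F G F' G' : C ⥤ C}

lemma homEquiv_app_comp (adj₁ : F ⊣ F') (adj₂ : G ⊣ G') (α : F ⟶ G) {K X : C}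
    (l : G.obj K ⟶ X) :
    adj₁.homEquiv K X (α.app K ≫ l) =
      adj₂.homEquiv K X l ≫ (conjugateEquiv adj₂ adj₁ α).app X := by
  simp only [homEquiv_unit, Functor.map_comp, Category.assoc]
  rw [(conjugateEquiv adj₂ adj₁ α).naturality l, ← Category.assoc, ← Category.assoc,
    unit_conjugateEquiv]

/-- The Leibniz adjunction: for a natural transformation `α : F ⟶ G` of left adjoint functors, the
pushout corner map of `α` and `i` lifts against `p` if and only if `i` lifts against the pullback
corner map of `p` and of the conjugate of `α`. -/
lemma hasLiftingProperty_pushout_desc_iff [HasPushouts C] [HasPullbacks C]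
    (adj₁ : F ⊣ F') (adj₂ : G ⊣ G') (α : F ⟶ G) {K L X Y : C} (i : K ⟶ L) (p : X ⟶ Y) :
    HasLiftingProperty
        (pushout.desc (f := F.map i) (g := α.app K) (α.app L) (G.map i) (α.naturality i)) p ↔
      HasLiftingProperty i
        (pullback.lift (f := F'.map p) (g := (conjugateEquiv adj₂ adj₁ α).app Y)
          ((conjugateEquiv adj₂ adj₁ α).app X) (G'.map p)
          ((conjugateEquiv adj₂ adj₁ α).naturality p).symm) := by
  -- Lifting squares are transposed componentwise: `inl` and `fst` correspond under `adj₁`, `inr`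
  -- and `snd` under `adj₂`.
  constructor
  · refine fun _ => ⟨fun {a b} sq => ?_⟩
    have h₁ : F.map i ≫ (adj₁.homEquiv _ _).symm (b ≫ pullback.fst _ _) =
        α.app K ≫ (adj₂.homEquiv _ _).symm a := by
      apply (adj₁.homEquiv _ _).injective
      rw [homEquiv_app_comp adj₁ adj₂, homEquiv_naturality_left, Equiv.apply_symm_apply,
        Equiv.apply_symm_apply, ← sq.w_assoc, pullback.lift_fst]
    have sq' : CommSq (pushout.desc _ _ h₁)
        (pushout.desc (f := F.map i) (g := α.app K) (α.app L) (G.map i) (α.naturality i)) p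
        ((adj₂.homEquiv _ _).symm (b ≫ pullback.snd _ _)) := by
      constructor
      apply pushout.hom_ext
      · apply (adj₁.homEquiv _ _).injective
        simp only [pushout.inl_desc_assoc]
        rw [homEquiv_app_comp adj₁ adj₂, homEquiv_naturality_right]
        simp [pullback.condition]
      · apply (adj₂.homEquiv _ _).injective
        simp only [pushout.inr_desc_assoc]
        rw [homEquiv_naturality_right, homEquiv_naturality_left, Equiv.apply_symm_apply,
          Equiv.apply_symm_apply, ← sq.w_assoc, pullback.lift_snd]
    refine ⟨⟨⟨adj₂.homEquiv _ _ sq'.lift, ?_, ?_⟩⟩⟩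
    · have := pushout.inr _ _ ≫= sq'.fac_left
      rw [pushout.inr_desc_assoc, pushout.inr_desc] at this
      rw [← homEquiv_naturality_left, this, Equiv.apply_symm_apply]
    · apply pullback.hom_ext
      · have := pushout.inl _ _ ≫= sq'.fac_left
        rw [pushout.inl_desc_assoc, pushout.inl_desc] at this
        rw [Category.assoc, pullback.lift_fst, ← homEquiv_app_comp adj₁ adj₂, this,
          Equiv.apply_symm_apply]
      · rw [Category.assoc, pullback.lift_snd, ← homEquiv_naturality_right, sq'.fac_right,
          Equiv.apply_symm_apply]
  · refine fun _ => ⟨fun {a b} sq => ?_⟩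
    have hl := pushout.inl _ _ ≫= sq.w
    have hr := pushout.inr _ _ ≫= sq.w
    rw [pushout.inl_desc_assoc] at hl
    rw [pushout.inr_desc_assoc] at hr
    have h₁ : adj₁.homEquiv _ _ (pushout.inl _ _ ≫ a) ≫ F'.map p =
        adj₂.homEquiv _ _ b ≫ (conjugateEquiv adj₂ adj₁ α).app Y := by
      rw [← homEquiv_app_comp adj₁ adj₂, ← hl, ← homEquiv_naturality_right, Category.assoc]
    have sq' : CommSq (adj₂.homEquiv _ _ (pushout.inr _ _ ≫ a)) i
        (pullback.lift (f := F'.map p) (g := (conjugateEquiv adj₂ adj₁ α).app Y)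
          ((conjugateEquiv adj₂ adj₁ α).app X) (G'.map p)
          ((conjugateEquiv adj₂ adj₁ α).naturality p).symm)
        (pullback.lift _ _ h₁) := by
      constructor
      apply pullback.hom_ext
      · rw [Category.assoc, pullback.lift_fst, Category.assoc, pullback.lift_fst,
          ← homEquiv_app_comp adj₁ adj₂, ← homEquiv_naturality_left, pushout.condition_assoc]
      · rw [Category.assoc, pullback.lift_snd, Category.assoc, pullback.lift_snd,
          ← homEquiv_naturality_right, ← homEquiv_naturality_left, ← hr, Category.assoc]
    refine ⟨⟨⟨(adj₂.homEquiv _ _).symm sq'.lift, ?_, ?_⟩⟩⟩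
    · apply pushout.hom_ext
      · rw [pushout.inl_desc_assoc]
        apply (adj₁.homEquiv _ _).injective
        have := sq'.fac_right =≫ pullback.fst _ _
        rw [Category.assoc, pullback.lift_fst, pullback.lift_fst] at this
        rw [homEquiv_app_comp adj₁ adj₂, Equiv.apply_symm_apply, this]
      · rw [pushout.inr_desc_assoc]
        apply (adj₂.homEquiv _ _).injective
        rw [homEquiv_naturality_left, Equiv.apply_symm_apply, sq'.fac_left]
    · apply (adj₂.homEquiv _ _).injective
      have := sq'.fac_right =≫ pullback.snd _ _
      rw [Category.assoc, pullback.lift_snd, pullback.lift_snd] at this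
      rw [homEquiv_naturality_right, Equiv.apply_symm_apply, this]

/-- If the pushout corner maps of `α` with the elements of `M` are in `T.llp`, then so are the
pushout corner maps of `α` with the elements of `M.rlp.llp`. -/
lemma llp_pushout_desc_of_rlp_llp [HasPushouts C] [HasPullbacks C]
    (adj₁ : F ⊣ F') (adj₂ : G ⊣ G') (α : F ⟶ G) (M T : MorphismProperty C)
    (hM : ∀ ⦃K L : C⦄ (i : K ⟶ L), M i →
      T.llp (pushout.desc (f := F.map i) (g := α.app K) (α.app L) (G.map i) (α.naturality i)))
    {K L : C} (i : K ⟶ L) (hi : M.rlp.llp i) :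
    T.llp (pushout.desc (f := F.map i) (g := α.app K) (α.app L) (G.map i) (α.naturality i)) := by
  intro X Y p hp
  rw [hasLiftingProperty_pushout_desc_iff adj₁ adj₂]
  refine hi _ fun _ _ j hj => ?_
  rw [← hasLiftingProperty_pushout_desc_iff adj₁ adj₂]
  exact hM j hj p hp

/-- The functor `X ↦ X ⨿ X` is left adjoint to the functor `X ↦ X ⨯ X`. -/
noncomputable def coprodSelfProdSelf (C : Type*) [Category* C] [HasBinaryCoproducts C]
    [HasBinaryProducts C] :
    ({ obj := fun X => X ⨿ X, map := fun f => coprod.map f f } : C ⥤ C) ⊣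
      { obj := fun X => X ⨯ X, map := fun f => prod.map f f } :=
  Adjunction.mkOfHomEquiv
    { homEquiv := fun X Y =>
        { toFun := fun f => prod.lift (coprod.inl ≫ f) (coprod.inr ≫ f)
          invFun := fun f => coprod.desc (f ≫ prod.fst) (f ≫ prod.snd)
          left_inv := fun f => coprod.hom_ext
            ((coprod.inl_desc _ _).trans (prod.lift_fst _ _))
            ((coprod.inr_desc _ _).trans (prod.lift_snd _ _))
          right_inv := fun f => Limits.prod.hom_ext
            ((prod.lift_fst _ _).trans (coprod.inl_desc _ _))
            ((prod.lift_snd _ _).trans (coprod.inr_desc _ _)) } }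

end CategoryTheory.Adjunction

namespace FunctorialCylinder

variable {C : Type u} [Category.{v} C] [HasPushouts C] [IsLocallyPresentable.{v} C]
  (J : FunctorialCylinder C) {M T : MorphismProperty C}

lemma endBox_mem_of_rlp_llp [PreservesColimitsOfSize.{v, v} J.I] (e : Fin 2)
    (hM : ∀ ⦃X Y : C⦄ (i : X ⟶ Y), M i → T.llp (J.endBox e i))
    ⦃X Y : C⦄ (i : X ⟶ Y) (hi : M.rlp.llp i) : T.llp (J.endBox e i) := by
  have := IsLocallyPresentable.hasLimits C
  have := IsLocallyPresentable.isLeftAdjoint_of_preservesColimits J.I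
  exact Adjunction.id.llp_pushout_desc_of_rlp_llp (.ofIsLeftAdjoint J.I) (J.d e) M T hM i hi

lemma boundaryBox_mem_of_rlp_llp [HasBinaryCoproducts C]
    [PreservesColimitsOfSize.{v, v} J.I]
    (hM : ∀ ⦃X Y : C⦄ (i : X ⟶ Y), M i → T.llp (J.boundaryBox i))
    ⦃X Y : C⦄ (i : X ⟶ Y) (hi : M.rlp.llp i) : T.llp (J.boundaryBox i) := by
  have := IsLocallyPresentable.hasLimits C
  have := IsLocallyPresentable.isLeftAdjoint_of_preservesColimits J.I
  exact (Adjunction.coprodSelfProdSelf C).llp_pushout_desc_of_rlp_llp (.ofIsLeftAdjoint J.I)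
    { app := J.boundary, naturality := fun _ _ i => J.boundary_naturality i } M T hM i hi

end FunctorialCylinder

/-! ### Small generation of the anodyne extensions. -/

namespace ElementaryHomotopicalDatum

variable {C : Type u} [Category.{v} C] [HasPushouts C] [HasBinaryCoproducts C]
  {L : MorphismProperty C} (D : ElementaryHomotopicalDatum L)

/-- Generators for the `e`-anodyne extensions, given generators `M` of the left class. -/
inductive anodyneGenerators (e : Fin 2) (M : MorphismProperty C) : MorphismProperty C
  | of_S {X Y : C} (i : X ⟶ Y) : D.S i → anodyneGenerators e M i
  | endBox {X Y : C} (i : X ⟶ Y) : M i → anodyneGenerators e M (D.cyl.endBox e i)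
  | boundaryBox {X Y : C} (i : X ⟶ Y) :
      anodyneGenerators e M i → anodyneGenerators e M (D.cyl.boundaryBox i)

/-- Each generator is an `n`-fold `∂I ⊠ -` applied to an element of `S` or to some `∂_e ⊠ i` with
`i` in `M`, so `(S ⊕ M) × ℕ` indexes them all. -/
lemma isSmall_anodyneGenerators (e : Fin 2) (M : MorphismProperty C)
    [MorphismProperty.IsSmall.{v} M] :
    MorphismProperty.IsSmall.{v} (D.anodyneGenerators e M) := by
  have := D.small
  let φ₀ : D.S.toSet ⊕ M.toSet → Arrow C :=
    Sum.elim (fun f => f.1) (fun f => Arrow.mk (D.cyl.endBox e f.1.hom))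
  let φ (x : (D.S.toSet ⊕ M.toSet) × ℕ) : Arrow C :=
    Nat.rec (φ₀ x.1) (fun _ f => Arrow.mk (D.cyl.boundaryBox f.hom)) x.2
  have hφ {X Y : C} (i : X ⟶ Y) (hi : D.anodyneGenerators e M i) :
      Arrow.mk i ∈ Set.range φ := by
    induction hi with
    | of_S i hi => exact ⟨(.inl ⟨Arrow.mk i, hi⟩, 0), rfl⟩
    | endBox i hi => exact ⟨(.inr ⟨Arrow.mk i, hi⟩, 0), rfl⟩
    | boundaryBox i _ h =>
      obtain ⟨⟨x, n⟩, hx⟩ := h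
      exact ⟨(x, n + 1), congrArg (fun f : Arrow C => Arrow.mk (D.cyl.boundaryBox f.hom)) hx⟩
  exact ⟨small_subset (s := Set.range φ) fun f hf =>
    hφ f.hom ((MorphismProperty.arrow_mk_mem_toSet_iff _ f.hom).1 hf)⟩

lemma anodyneGenerators_le (e : Fin 2) {M : MorphismProperty C} (hM : M ≤ L) :
    D.anodyneGenerators e M ≤ L := by
  intro X Y i hi
  induction hi with
  | of_S i hi => exact D.S_le i hi
  | endBox i hi => exact D.exact.endBox_mem e i (hM i hi)
  | boundaryBox i _ h => exact D.exact.boundaryBox_mem i h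

variable [IsLocallyPresentable.{v} C]

lemma isAnodyneClass_rlp_llp (e : Fin 2) (M : MorphismProperty C)
    [MorphismProperty.IsSmall.{v} M] (hM : L = M.rlp.llp) :
    D.cyl.IsAnodyneClass e L (D.anodyneGenerators e M).rlp.llp := by
  have := D.exact.preservesColimits
  have hle := D.anodyneGenerators_le e (M.le_llp_rlp.trans hM.ge)
  refine ⟨?_, ⟨_, D.isSmall_anodyneGenerators e M, hle, rfl⟩, ?_, ?_⟩
  · refine (MorphismProperty.antitone_llp (MorphismProperty.antitone_rlp hle)).trans ?_
    conv_lhs => rw [hM, MorphismProperty.llp_rlp_llp]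
    exact hM.ge
  · exact fun _ _ i hi => D.cyl.endBox_mem_of_rlp_llp e (fun _ _ i hi =>
      MorphismProperty.le_llp_rlp _ _ (.endBox i hi)) i (hM.le i hi)
  · exact D.cyl.boundaryBox_mem_of_rlp_llp fun _ _ i hi =>
      MorphismProperty.le_llp_rlp _ _ (.boundaryBox i hi)

/-- The saturation is one of the classes being intersected. Conversely each such class contains the
generators by induction, and is saturated by its own `generated` field. -/
lemma anodyne_eq_rlp_llp (e : Fin 2) (M : MorphismProperty C)
    [MorphismProperty.IsSmall.{v} M] (hM : L = M.rlp.llp) :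
    D.anodyne e = (D.anodyneGenerators e M).rlp.llp := by
  apply le_antisymm
  · intro X Y f hf
    exact hf _ (D.isAnodyneClass_rlp_llp e M hM) fun _ _ i hi =>
      MorphismProperty.le_llp_rlp _ _ (.of_S i hi)
  · intro X Y f hf An hAn hS
    obtain ⟨G, _, _, hG⟩ := hAn.generated
    have hle : D.anodyneGenerators e M ≤ An := by
      intro X Y i hi
      induction hi with
      | of_S i hi => exact hS i hi
      | endBox i hi => exact hAn.endBox_mem i (hM.ge i (M.le_llp_rlp i hi))
      | boundaryBox i _ h => exact hAn.boundaryBox_mem i h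
    have := MorphismProperty.antitone_llp (MorphismProperty.antitone_rlp hle) f hf
    rwa [hG, MorphismProperty.llp_rlp_llp, ← hG] at this

/-- The smallest class of `e`-anodyne extensions containing `S` is a class of `e`-anodyne
extensions. -/
lemma isAnodyneClass_anodyne (e : Fin 2)
    (hL : ∃ M : MorphismProperty C, MorphismProperty.IsSmall.{v} M ∧ L = M.rlp.llp) :
    D.cyl.IsAnodyneClass e L (D.anodyne e) := by
  obtain ⟨M, _, hM⟩ := hL
  rw [D.anodyne_eq_rlp_llp e M hM]
  exact D.isAnodyneClass_rlp_llp e M hM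

end ElementaryHomotopicalDatum

/-! ### Homotopies and fibrant objects in slices. -/

namespace FunctorialCylinder

variable {C : Type u} [Category.{v} C] (J : FunctorialCylinder C)

@[simp]
lemma d_app_σ_app (e : Fin 2) (X : C) : (J.d e).app X ≫ J.σ.app X = 𝟙 X :=
  congrArg (fun t => t.app X) (J.d_σ e)

@[simp]
lemma d_app_σ_app_assoc (e : Fin 2) (X : C) {Z : C} (g : X ⟶ Z) :
    (J.d e).app X ≫ J.σ.app X ≫ g = g := by
  rw [← Category.assoc, d_app_σ_app]
  exact Category.id_comp g

lemma d_naturality_assoc (e : Fin 2) {X Y Z : C} (f : X ⟶ Y) (g : J.I.obj Y ⟶ Z) :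
    f ≫ (J.d e).app Y ≫ g = (J.d e).app X ≫ J.I.map f ≫ g := by
  simpa using (J.d e).naturality f =≫ g

lemma σ_naturality_assoc {X Y Z : C} (f : X ⟶ Y) (g : Y ⟶ Z) :
    J.I.map f ≫ J.σ.app Y ≫ g = J.σ.app X ≫ f ≫ g := by
  simp

section Precomp

lemma precomp_comp {X Y Z : C} (f : X ⟶ Y) (g : Y ⟶ Z) (W : C) :
    J.precomp (f ≫ g) W = J.precomp f W ∘ J.precomp g W := by
  funext x
  induction x using Quot.ind with
  | mk h => exact congrArg (Quot.mk _) (Category.assoc f g h)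

lemma precomp_eq_id {X : C} {f : X ⟶ X} (hf : J.Homotopic (𝟙 X) f) (W : C) :
    J.precomp f W = id := by
  obtain ⟨h, h₀, h₁⟩ := hf
  funext x
  induction x using Quot.ind with
  | mk g => exact (Quot.sound ⟨h ≫ g, by simp [reassoc_of% h₀], by simp [reassoc_of% h₁]⟩).symm

/-- Precomposition with a homotopy equivalence onto a retract is bijective. -/
lemma precomp_bijective_of_section {X Y : C} {p : X ⟶ Y} {s : Y ⟶ X} (hs : s ≫ p = 𝟙 Y)
    (hp : J.Homotopic (𝟙 X) (p ≫ s)) (W : C) : Function.Bijective (J.precomp p W) := by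
  have h₁ : J.precomp s W ∘ J.precomp p W = id := by
    rw [← precomp_comp, hs]
    exact J.precomp_eq_id ⟨J.σ.app Y, J.d_app_σ_app 0 Y, J.d_app_σ_app 1 Y⟩ W
  have h₂ : J.precomp p W ∘ J.precomp s W = id := by
    rw [← precomp_comp, J.precomp_eq_id hp]
  exact ⟨(Function.leftInverse_iff_comp.2 h₁).injective,
    (Function.rightInverse_iff_comp.2 h₂).surjective⟩

end Precomp

section Slice

variable {A : C}

/-- Homotopies in `C/A`, with prescribed ends `e` and `e'`. -/
def HomotopicOver (e e' : Fin 2) {X W : Over A} (f g : X ⟶ W) : Prop :=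
  ∃ h : J.I.obj X.left ⟶ W.left, h ≫ W.hom = J.σ.app X.left ≫ X.hom ∧
    (J.d e).app X.left ≫ h = f.left ∧ (J.d e').app X.left ≫ h = g.left

variable {J}

lemma HomotopicOver.symm {e e' : Fin 2} {X W : Over A} {f g : X ⟶ W}
    (h : J.HomotopicOver e e' f g) : J.HomotopicOver e' e g f :=
  let ⟨k, hk, h₁, h₂⟩ := h
  ⟨k, hk, h₂, h₁⟩

lemma HomotopicOver.refl (e e' : Fin 2) {X W : Over A} (f : X ⟶ W) :
    J.HomotopicOver e e' f f :=
  ⟨J.σ.app X.left ≫ f.left, by simp, by simp, by simp⟩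

lemma slice_homotopic_iff {X W : Over A} {f g : X ⟶ W} :
    (J.slice A).Homotopic f g ↔ J.HomotopicOver 0 1 f g := by
  constructor
  · rintro ⟨h, rfl, rfl⟩
    exact ⟨h.left, Over.w h, rfl, rfl⟩
  · rintro ⟨h, h₀, h₁, h₂⟩
    exact ⟨Over.homMk h h₀, Over.OverMorphism.ext h₁, Over.OverMorphism.ext h₂⟩

/-- A square over the terminal object of `C/A` is the same as a square in `C` over `W.hom` whose
bottom map is a structure map to `A`. -/
lemma isFibrant_inverseImage_forget_iff {An : MorphismProperty C} {W : Over A} :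
    IsFibrant (An.inverseImage (Over.forget A)) W ↔ An.rlp W.hom := by
  constructor
  · refine fun h X Y i hi => ⟨fun {a b} sq => ?_⟩
    let i' : Over.mk (i ≫ b) ⟶ Over.mk b := Over.homMk i
    have := h i' hi
    have sq' : CommSq (Over.homMk a sq.w : Over.mk (i ≫ b) ⟶ W) i' (terminal.from W)
      (terminal.from _) := ⟨Subsingleton.elim _ _⟩
    exact ⟨⟨⟨sq'.lift.left, congrArg CommaMorphism.left sq'.fac_left, Over.w sq'.lift⟩⟩⟩
  · refine fun h X Y i hi => ⟨fun {a b} sq => ?_⟩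
    have := h i.left hi
    have sq' : CommSq a.left i.left W.hom Y.hom := ⟨by simp⟩
    exact ⟨⟨⟨Over.homMk sq'.lift sq'.fac_right, Over.OverMorphism.ext sq'.fac_left,
      Subsingleton.elim _ _⟩⟩⟩

end Slice

section EndBox

variable {J} [HasPushouts C]

lemma inl_endBox (e : Fin 2) {X Y : C} (i : X ⟶ Y) :
    pushout.inl _ _ ≫ J.endBox e i = (J.d e).app Y :=
  pushout.inl_desc _ _ _

lemma inr_endBox (e : Fin 2) {X Y : C} (i : X ⟶ Y) :
    pushout.inr _ _ ≫ J.endBox e i = J.I.map i :=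
  pushout.inr_desc _ _ _

/-- Extension of a map along `∂_e ⊠ i`, with values in a fibration. -/
lemma exists_extension_endBox {X Y A : C} {e : Fin 2} (i : X ⟶ Y) {W : Over A}
    (hi : HasLiftingProperty (J.endBox e i) W.hom) (b : J.I.obj Y ⟶ A)
    (f : Y ⟶ W.left) (h : J.I.obj X ⟶ W.left) (w : i ≫ f = (J.d e).app X ≫ h)
    (hf : f ≫ W.hom = (J.d e).app Y ≫ b) (hh : h ≫ W.hom = J.I.map i ≫ b) :
    ∃ l : J.I.obj Y ⟶ W.left, (J.d e).app Y ≫ l = f ∧ J.I.map i ≫ l = h ∧ l ≫ W.hom = b := by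
  have sq : CommSq (pushout.desc f h w) (J.endBox e i) W.hom b := ⟨by
    apply pushout.hom_ext
    · rw [pushout.inl_desc_assoc, reassoc_of% inl_endBox e i, hf]
    · rw [pushout.inr_desc_assoc, reassoc_of% inr_endBox e i, hh]⟩
  refine ⟨sq.lift, ?_, ?_, sq.fac_right⟩
  · have := pushout.inl _ _ ≫= sq.fac_left
    rwa [reassoc_of% inl_endBox e i, pushout.inl_desc] at this
  · have := pushout.inr _ _ ≫= sq.fac_left
    rwa [reassoc_of% inr_endBox e i, pushout.inr_desc] at this

end EndBox

section Fibrant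

variable {J} [HasBinaryCoproducts C]

lemma inl_boundary (X : C) : coprod.inl ≫ J.boundary X = (J.d 0).app X :=
  coprod.inl_desc _ _

lemma inr_boundary (X : C) : coprod.inr ≫ J.boundary X = (J.d 1).app X :=
  coprod.inr_desc _ _

variable [HasPushouts C]

lemma inl_boundaryBox {X Y : C} (i : X ⟶ Y) :
    pushout.inl _ _ ≫ J.boundaryBox i = J.boundary Y :=
  pushout.inl_desc _ _ _

lemma inr_boundaryBox {X Y : C} (i : X ⟶ Y) :
    pushout.inr _ _ ≫ J.boundaryBox i = J.I.map i :=
  pushout.inr_desc _ _ _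

variable {L An : MorphismProperty C} {e : Fin 2} {A : C}

/-- Homotopies into a fibrant object of `C/A` compose along the end `e`. -/
lemma HomotopicOver.of_common_end [PreservesColimitsOfSize.{v, v} J.I] {e' : Fin 2}
    {X W : Over A} (hW : HasLiftingProperty (J.endBox e (J.boundary X.left)) W.hom)
    {w u₀ u₁ : X ⟶ W} (h₀ : J.HomotopicOver e e' w u₀) (h₁ : J.HomotopicOver e e' w u₁) :
    J.HomotopicOver 0 1 u₀ u₁ := by
  obtain ⟨k₀, hk₀, hw₀, hu₀⟩ := h₀
  obtain ⟨k₁, hk₁, hw₁, hu₁⟩ := h₁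
  have hc := isColimitOfHasBinaryCoproductOfPreservesColimit J.I X.left X.left
  obtain ⟨k, hl, hr⟩ : ∃ k : J.I.obj (X.left ⨿ X.left) ⟶ W.left,
      J.I.map coprod.inl ≫ k = k₀ ∧ J.I.map coprod.inr ≫ k = k₁ :=
    ⟨hc.desc (BinaryCofan.mk k₀ k₁), hc.fac _ ⟨.left⟩, hc.fac _ ⟨.right⟩⟩
  -- The constant homotopy at `w` is put on end `e` of `I (I X)`, and the two given homotopies on
  -- its two sides. The end `e'` of the filler joins `u₀` to `u₁`.
  obtain ⟨l, -, hl₂, hl₃⟩ := exists_extension_endBox (J.boundary X.left) hW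
    (J.σ.app _ ≫ J.σ.app _ ≫ X.hom) (J.σ.app _ ≫ w.left) k
    (by
      apply coprod.hom_ext
      · rw [J.d_naturality_assoc, hl, hw₀, reassoc_of% inl_boundary X.left, d_app_σ_app_assoc]
      · rw [J.d_naturality_assoc, hr, hw₁, reassoc_of% inr_boundary X.left, d_app_σ_app_assoc])
    (by simp)
    (by
      apply BinaryCofan.IsColimit.hom_ext hc
      · change J.I.map coprod.inl ≫ _ = J.I.map coprod.inl ≫ _
        rw [reassoc_of% hl, hk₀, ← J.I.map_comp_assoc, inl_boundary, J.σ_naturality_assoc,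
          d_app_σ_app_assoc]
      · change J.I.map coprod.inr ≫ _ = J.I.map coprod.inr ≫ _
        rw [reassoc_of% hr, hk₁, ← J.I.map_comp_assoc, inr_boundary, J.σ_naturality_assoc,
          d_app_σ_app_assoc])
  refine ⟨(J.d e').app _ ≫ l, by simp [hl₃], ?_, ?_⟩
  · rw [J.d_naturality_assoc, ← hu₀, ← hl, ← hl₂, ← J.I.map_comp_assoc, inl_boundary]
    rfl
  · rw [J.d_naturality_assoc, ← hu₁, ← hr, ← hl₂, ← J.I.map_comp_assoc, inr_boundary]
    rfl

/-- Homotopy of maps to a fibrant object of `C/A` is an equivalence relation. -/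
lemma homotopic_equivalence (hJ : J.IsExact L) (hAn : J.IsAnodyneClass e L An) (X : Over A)
    {W : Over A} (hW : An.rlp W.hom) :
    Equivalence fun f g : X ⟶ W => (J.slice A).Homotopic f g := by
  have := hJ.preservesColimits
  have hlift := hW _ (hAn.endBox_mem _ (hJ.boundary_mem X.left))
  simp only [slice_homotopic_iff]
  -- Only homotopies sharing their end `e` can be composed; taking one of them constant gives
  -- symmetry, and then transitivity follows.
  have he : e = 0 ∨ e = 1 := by fin_cases e <;> simp
  obtain rfl | rfl := he
  · exact {
      refl := HomotopicOver.refl 0 1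
      symm := fun h => .of_common_end hlift h (.refl 0 1 _)
      trans := fun h h' => .of_common_end hlift (.of_common_end hlift h (.refl 0 1 _)) h' }
  · exact {
      refl := HomotopicOver.refl 0 1
      symm := fun h => .of_common_end hlift (.refl 1 0 _) h.symm
      trans := fun h h' => .of_common_end hlift h.symm
        (HomotopicOver.of_common_end hlift (.refl 1 0 _) h'.symm).symm }

/-- Replaces zigzags of homotopies by a single homotopy, to which lifting properties apply. -/
lemma quot_mk_eq_iff (hJ : J.IsExact L) (hAn : J.IsAnodyneClass e L An) {X W : Over A}
    (hW : An.rlp W.hom) {f g : X ⟶ W} :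
    Quot.mk (fun f g : X ⟶ W => (J.slice A).Homotopic f g) f = Quot.mk _ g ↔
      (J.slice A).Homotopic f g :=
  Quot.eq.trans (homotopic_equivalence hJ hAn X hW).eqvGen_iff

lemma isWeakEquivalence_of_anodyne (hJ : J.IsExact L) (hAn : J.IsAnodyneClass e L An)
    {X Y : Over A} (i : X ⟶ Y) (hi : An i.left) :
    (J.slice A).IsWeakEquivalence (An.inverseImage (Over.forget A)) i := by
  intro W hW
  rw [isFibrant_inverseImage_forget_iff] at hW
  constructor
  · intro x y hxy
    induction x using Quot.ind with | mk g₀ => ?_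
    induction y using Quot.ind with | mk g₁ => ?_
    obtain ⟨h, hh, h₀, h₁⟩ := slice_homotopic_iff.1 ((quot_mk_eq_iff hJ hAn hW).1 hxy)
    have := hW _ (hAn.boundaryBox_mem _ hi)
    have w : coprod.map i.left i.left ≫ coprod.desc g₀.left g₁.left =
        J.boundary X.left ≫ h := by
      rw [coprod.map_desc]
      apply coprod.hom_ext
      · rw [coprod.inl_desc, reassoc_of% inl_boundary X.left, h₀, Over.comp_left]
      · rw [coprod.inr_desc, reassoc_of% inr_boundary X.left, h₁, Over.comp_left]
    have sq : CommSq (pushout.desc _ h w) (J.boundaryBox i.left) W.hom (J.σ.app _ ≫ Y.hom) := ⟨by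
      apply pushout.hom_ext
      · rw [pushout.inl_desc_assoc, reassoc_of% inl_boundaryBox i.left]
        apply coprod.hom_ext
        · rw [coprod.inl_desc_assoc, reassoc_of% inl_boundary Y.left, d_app_σ_app_assoc, Over.w]
        · rw [coprod.inr_desc_assoc, reassoc_of% inr_boundary Y.left, d_app_σ_app_assoc, Over.w]
      · rw [pushout.inr_desc_assoc, reassoc_of% inr_boundaryBox i.left, hh,
          J.σ_naturality_assoc, Over.w]⟩
    have hl : J.boundary Y.left ≫ sq.lift = coprod.desc g₀.left g₁.left := by
      have := pushout.inl _ _ ≫= sq.fac_left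
      rwa [reassoc_of% inl_boundaryBox i.left, pushout.inl_desc] at this
    refine Quot.sound (slice_homotopic_iff.2 ⟨sq.lift, sq.fac_right, ?_, ?_⟩)
    · have := coprod.inl ≫= hl
      rw [reassoc_of% inl_boundary Y.left] at this
      exact this.trans (coprod.inl_desc _ _)
    · have := coprod.inr ≫= hl
      rw [reassoc_of% inr_boundary Y.left] at this
      exact this.trans (coprod.inr_desc _ _)
  · intro x
    induction x using Quot.ind with | mk g => ?_
    have := hW _ hi
    have sq : CommSq g.left i.left W.hom Y.hom := ⟨by simp⟩
    exact ⟨Quot.mk _ (Over.homMk sq.lift sq.fac_right),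
      congrArg (Quot.mk _) (Over.OverMorphism.ext sq.fac_left)⟩

/-- A map with the right lifting property against `L` whose target is `L`-cofibrant is a homotopy
equivalence over its target. -/
lemma isWeakEquivalence_of_rlp [HasInitial C] (hJ : J.IsExact L) {E Y : Over A} (p : E ⟶ Y)
    (hY : L (initial.to Y.left)) (hp : L.rlp p.left) (An : MorphismProperty (Over A)) :
    (J.slice A).IsWeakEquivalence An p := by
  have := hp _ hY
  have := hp _ (hJ.boundary_mem E.left)
  have sq : CommSq (initial.to E.left) (initial.to Y.left) p.left (𝟙 _) :=
    ⟨initial.hom_ext _ _⟩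
  have hs : sq.lift ≫ p.left = 𝟙 Y.left := sq.fac_right
  let s : Y ⟶ E := Over.homMk sq.lift (by rw [← Over.w p, reassoc_of% hs])
  -- Both ends become `p` after composing with `p`, so the constant homotopy at `p` can be lifted.
  have sq' : CommSq (coprod.desc (𝟙 E.left) (p.left ≫ sq.lift)) (J.boundary E.left) p.left
      (J.σ.app _ ≫ p.left) :=
    ⟨by
      apply coprod.hom_ext
      · rw [coprod.inl_desc_assoc, reassoc_of% inl_boundary E.left, d_app_σ_app_assoc,
          Category.id_comp]
      · rw [coprod.inr_desc_assoc, reassoc_of% inr_boundary E.left, d_app_σ_app_assoc,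
          Category.assoc, hs, Category.comp_id]⟩
  refine fun W _ => precomp_bijective_of_section _ (s := s) (Over.OverMorphism.ext hs)
    (slice_homotopic_iff.2 ⟨sq'.lift, ?_, ?_, ?_⟩) W
  · rw [← Over.w p, reassoc_of% sq'.fac_right]
  · have := coprod.inl ≫= sq'.fac_left
    rwa [reassoc_of% inl_boundary E.left, coprod.inl_desc] at this
  · have := coprod.inr ≫= sq'.fac_left
    rwa [reassoc_of% inr_boundary E.left, coprod.inr_desc] at this

/-- A fibration which is a weak equivalence over its target has the right lifting property against
the left class. -/
lemma rlp_of_isWeakEquivalence (hJ : J.IsExact L) (hAn : J.IsAnodyneClass e L An) {E : Over A}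
    (hE : An.rlp E.hom) (p : E ⟶ Over.mk (𝟙 A))
    (hp : (J.slice A).IsWeakEquivalence (An.inverseImage (Over.forget A)) p) :
    L.rlp E.hom := by
  obtain ⟨x, hx⟩ := (hp E (isFibrant_inverseImage_forget_iff.2 hE)).surjective (Quot.mk _ (𝟙 E))
  induction x using Quot.ind with | mk s => ?_
  replace hx : (J.slice A).Homotopic (p ≫ s) (𝟙 E) := (quot_mk_eq_iff hJ hAn hE).1 hx
  -- The homotopy is oriented so that `p ≫ s` sits at the end `e` where `∂_e ⊠ j` allows extension.
  obtain ⟨e', hx⟩ : ∃ e', J.HomotopicOver e e' (p ≫ s) (𝟙 E) := by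
    have he : e = 0 ∨ e = 1 := by fin_cases e <;> simp
    obtain rfl | rfl := he
    · exact ⟨1, slice_homotopic_iff.1 hx⟩
    · exact ⟨0, (slice_homotopic_iff.1 ((homotopic_equivalence hJ hAn E hE).symm hx)).symm⟩
  obtain ⟨h, hh, h₁, h₂⟩ := hx
  have hp' : p.left = E.hom := by simpa using Over.w p
  have hs : s.left ≫ E.hom = 𝟙 A := Over.w s
  simp only [Over.comp_left, Over.id_left, hp'] at h₁ h₂
  refine fun K K' j hj => ⟨fun {a b} sq => ?_⟩
  obtain ⟨l, hl, hl', hl''⟩ := exists_extension_endBox (W := E) j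
    (hE _ (hAn.endBox_mem j hj)) (J.σ.app K' ≫ b) (b ≫ s.left) (J.I.map a ≫ h)
    (by rw [← J.d_naturality_assoc, h₁, reassoc_of% sq.w])
    (by simp [hs])
    (by rw [Category.assoc, hh, J.σ_naturality_assoc, sq.w, J.σ_naturality_assoc])
  exact ⟨⟨⟨(J.d e').app K' ≫ l,
    by rw [J.d_naturality_assoc, hl', ← J.d_naturality_assoc, h₂, Category.comp_id],
    by rw [Category.assoc, hl'', d_app_σ_app_assoc]⟩⟩⟩

/-- A map is a weak equivalence over every base of its target if and only if it factors as an
anodyne extension followed by a map with the right lifting property against the left class. -/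
theorem isWeakEquivalence_over_iff_exists_factorization [IsLocallyPresentable.{v} C] [HasInitial C]
    (hinit : ∀ X : C, L (initial.to X)) (hJ : J.IsExact L) (hAn : J.IsAnodyneClass e L An)
    {X Y : C} (f : X ⟶ Y) :
    (∀ (A : C) (p : Y ⟶ A), (J.slice A).IsWeakEquivalence (An.inverseImage (Over.forget A))
      (Over.homMk f : Over.mk (f ≫ p) ⟶ Over.mk p)) ↔
      ∃ (E : C) (i : X ⟶ E) (p : E ⟶ Y), An i ∧ L.rlp p ∧ i ≫ p = f := by
  constructor
  · intro hf
    obtain ⟨G, _, _, hG⟩ := hAn.generated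
    have := IsLocallyPresentable.hasSmallObjectArgument G
    let d := MorphismProperty.factorizationData G.rlp.llp G.rlp f
    have hi : An d.i := by rw [hG]; exact d.hi
    have hp : An.rlp d.p := by rw [hG, MorphismProperty.rlp_llp_rlp]; exact d.hp
    refine ⟨d.Z, d.i, d.p, hi, ?_, d.fac⟩
    -- Only the base `Y` with its identity is needed: there `p` becomes the map to the terminal
    -- object.
    let i : Over.mk (f ≫ 𝟙 Y) ⟶ Over.mk d.p := Over.homMk d.i (by simp)
    let p : Over.mk d.p ⟶ Over.mk (𝟙 Y) := Over.homMk d.p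
    have hip : i ≫ p = Over.homMk f := Over.OverMorphism.ext d.fac
    refine rlp_of_isWeakEquivalence hJ hAn (E := Over.mk d.p) hp p fun W hW => ?_
    have h := hf Y (𝟙 Y) W hW
    rw [← hip, precomp_comp] at h
    exact ((isWeakEquivalence_of_anodyne hJ hAn i hi W hW).of_comp_iff' _).1 h
  · rintro ⟨E, i, p, hi, hp, rfl⟩ A q W hW
    let i' : Over.mk ((i ≫ p) ≫ q) ⟶ Over.mk (p ≫ q) := Over.homMk i
    let p' : Over.mk (p ≫ q) ⟶ Over.mk q := Over.homMk p
    have hip : i' ≫ p' = Over.homMk (i ≫ p) := Over.OverMorphism.ext rfl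
    rw [← hip, precomp_comp]
    exact (isWeakEquivalence_of_anodyne hJ hAn i' hi W hW).comp
      (isWeakEquivalence_of_rlp hJ p' (hinit Y) hp _ W hW)

end Fibrant

end FunctorialCylinder

theorem mainTheorem4 {C : Type u} [Category.{v} C] [IsLocallyPresentable.{v} C]
    (L R : MorphismProperty C) (hLR : MorphismProperty.IsWeakFactorizationSystem L R)
    (hgen : ∃ M : MorphismProperty C, MorphismProperty.IsSmall.{v} M ∧ L = M.rlp.llp)
    (hinit : ∀ X : C, L (initial.to X))
    (D : ElementaryHomotopicalDatum L) {X Y : C} (f : X ⟶ Y) :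
    (D.IsFinal f ↔
      ∃ (E : C) (i : X ⟶ E) (p : E ⟶ Y), D.rightAnodyne i ∧ R p ∧ i ≫ p = f) ∧
    (D.IsInitial f ↔
      ∃ (E : C) (i : X ⟶ E) (p : E ⟶ Y), D.leftAnodyne i ∧ R p ∧ i ≫ p = f) := by
  obtain rfl := hLR.rlp
  exact ⟨FunctorialCylinder.isWeakEquivalence_over_iff_exists_factorization hinit D.exact
      (D.isAnodyneClass_anodyne 1 hgen) f,
    FunctorialCylinder.isWeakEquivalence_over_iff_exists_factorization hinit D.exact
      (D.isAnodyneClass_anodyne 0 hgen) f⟩
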